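/- **Setting.** Fix a set of constants and a set of predicates with arities, two disjoint sets of which are the extensional and the intensional predicates. A *fact* is an atom whose terms are constants or nulls; a *base instance* is a finite set of atoms of constants over extensional predicates. A *rule* $r$ is a constant-free formula $\forall \vec X\forall\vec Y\,\bigwedge_{i=1}^n P_i(\vec X_i,\vec Y_i)\to\exists \vec Z\,P(\vec Y,\vec Z)$, $n\ge 1$, with $P$ intensional and with the $P_i$ all extensional ($r$ is then called extensional) or all intensional; it is *linear* if $n=1$. A *program* is a set of rules. A *homomorphism* between sets of facts is a map on terms that fixes constants and maps facts to facts; two sets of facts are *equivalent* if there are homomorphisms both ways. A *trigger* for $r$ in a set of facts $I$ is a homomorphism $h$ from the body of $r$ into $I$; $h_s$ extends $h$ by sending each existential variable $Z$ of $r$ to a null $n_{r,h,Z}$ determined by $r,h,Z$. A *model* of $(P,B)$ is a set of facts $M\supseteq B$ such that for each $r\in P$ every trigger for $r$ in $M$ extends to a homomorphism from the head of $r$ into $M$; it is *universal* if it maps homomorphically into every model of $(P,B)$. $P$ is *FES* (a finite expansion set) if $(P,B)$ has a finite universal model for every base instance $B$. A Boolean conjunctive query (BCQ) $Q$ is a finite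 conjunction of null-free atoms; $I\models Q$ if $Q$ maps homomorphically into $I$, and $(P,B)\models Q$ if $M\models Q$ for every model $M$ of $(P,B)$. **Chase.** Let $I^0=I$ and $I^{i+1}=I^i\cup\{h_s(\mathrm{head}(r)) : r\in P,\ h \text{ a trigger for } r \text{ in } I^i\}$. The *equivalent chase* of $(P,I)$ is $I^i$ for the least $i$ such that $I^{i+1}$ is equivalent to $I^i$ (and $\bigcup_i I^i$ if there is none). A *chase graph* of $(P,I)$ has labelled edges $f_1\to_r f_2$ between facts of the chase, where $f_2$ is newly produced in some round by executing $r$ with a trigger that uses $f_1$; every derived fact has at least one incoming edge (if a fact is produced by several executions in the same round, any nonempty set of them may be recorded). **Trigger graphs.** An *execution graph* (EG) $G$ for $P$ is an acyclic digraph whose nodes $v$ are labelled with rules of $P$ and whose edges $u\to_j v$ are labelled with positions $j$ in the body of the rule of $v$, such that $u\to_j v$ only if the head predicate of the rule of $u$ is the $j$-th body predicate of the rule of $v$, and such that a node with a non-extensional rule has an incoming edge for each body position. For a base instance $B$, $v(B)$ is the set of all $h_s(\mathrm{head}(r))$, $r$ the rule of $v$, where $h$ is a trigger for $r$ in $B$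 if $r$ is extensional, and otherwise $h$ maps the $j$-th body atom of $r$ into $u_j(B)$ for each $j$, for some edges $u_j\to_j v$. Put $G(B)=B\cup\bigcup_v v(B)$. $G$ is an (instance-independent) *trigger graph* (TG) for $P$ if it is an EG for $P$ and, for every base instance $B$ and every BCQ $Q$, $(P,B)\models Q$ if and only if $G(B)\models Q$. **Algorithm.** Let $\mathcal H(P)$ contain exactly one representative of each pattern-isomorphism class of base facts over the extensional predicates that occur in $P$, where two such facts are pattern-isomorphic if they have the same predicate and a bijection between their constants maps one to the other. For $f\in\mathcal H(P)$ let $\Gamma_f$ have one fresh node, labelled $r$, for each edge $f_1\to_r f_2$ of a chase graph of $(P,\{f\})$, and an edge $v\to_1 u$ whenever $v$ is the node of an edge $f_1\to_r f_2$ and $u$ that of an edge $f_2\to_{r'}f_3$. Let $\mathsf{tgraphLinear}(P)$ be the disjoint union of the graphs $\Gamma_f$, $f\in\mathcal H(P)$. **Theorem.** Let $P$ be a linear program that is FES. Then, for every choice of $\mathcal H(P)$ and of the chase graphs, $\mathsf{tgraphLinear}(P)$ is an instance-independent trigger graph for $P$. If moreover each chase graph used records exactly one execution for each derived fact, then every node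 of $\mathsf{tgraphLinear}(P)$ has at most one incoming edge for each body position. -/

import Mathlib

/-! Existential rules, the (equivalent) chase, execution graphs and trigger graphs. -/

namespace TrigGraph

universe u v

/-- A vocabulary: predicates with arities, and two disjoint sets of extensional and
intensional predicates. -/
structure Schema where
  Pred : Type u
  arity : Pred → ℕ
  ext : Set Pred
  int : Set Pred
  disj : Disjoint ext int

/-- The countably infinite set of variables. -/
abbrev Var : Type := ℕ

/-- Atoms `p(t₁, …, tₙ)` over a set `T` of terms. -/
structure Atom (S : Schema.{u}) (T : Type v) where
  pred : S.Pred
  args : Fin (S.arity pred) → T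

/-- Apply a term mapping to an atom. -/
def Atom.map {S : Schema.{u}} {T T' : Type*} (g : T → T') (A : Atom S T) : Atom S T' :=
  ⟨A.pred, fun k => g (A.args k)⟩

/-- The set of terms of an atom. -/
def Atom.terms {S : Schema.{u}} {T : Type*} (A : Atom S T) : Set T := Set.range A.args

/-- A rule `⋀ᵢ Pᵢ(Xᵢ, Yᵢ) → ∃ Z, P(Y, Z)` (without constants). The variables of the head that do not
occur in the body are the existentially quantified ones. The head is intensional; the body is
nonempty and consists of extensional atoms only or of intensional atoms only. -/
structure Rule (S : Schema.{u}) where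
  len : ℕ
  len_pos : 0 < len
  body : Fin len → Atom S Var
  head : Atom S Var
  head_int : head.pred ∈ S.int
  body_uniform : (∀ i, (body i).pred ∈ S.ext) ∨ (∀ i, (body i).pred ∈ S.int)

namespace Rule

variable {S : Schema.{u}}

/-- The variables of the body. -/
def bodyVars (r : Rule S) : Set Var := {x | ∃ i, x ∈ (r.body i).terms}

/-- The universally quantified variables (those of the body), as a type. -/
def BodyVar (r : Rule S) : Type := {x : Var // x ∈ r.bodyVars}

/-- The existentially quantified variables, as a type. -/
def ExVar (r : Rule S) : Type := {z : Var // z ∈ r.head.terms ∧ z ∉ r.bodyVars}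

/-- A rule is extensional if its body includes only extensional atoms. -/
def IsExtensional (r : Rule S) : Prop := ∀ i, (r.body i).pred ∈ S.ext

/-- A rule is linear if it has a single atom in its body. -/
def IsLinear (r : Rule S) : Prop := r.len = 1

end Rule

/-- Ground terms: constants, and nulls. The null `null r h z` is the fresh null that is
invented for the existential variable `z` when `r` is executed with the trigger `h`. -/
inductive GTerm (S : Schema.{u}) (C : Type v) : Type (max u v) where
  | const (c : C) : GTerm S C
  | null (r : Rule S) (h : r.BodyVar → GTerm S C) (z : r.ExVar) : GTerm S C

/-- Facts: atoms of ground terms. -/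
abbrev Fact (S : Schema.{u}) (C : Type v) : Type (max u v) := Atom S (GTerm S C)

/-- A set of facts (possibly comprising nulls). -/
abbrev Facts (S : Schema.{u}) (C : Type v) : Type (max u v) := Set (Fact S C)

/-- A program is a set of rules. -/
abbrev Program (S : Schema.{u}) : Type u := Set (Rule S)

variable {S : Schema.{u}} {C : Type v}

/-- An atom of constants, seen as a fact. -/
def toFact (f : Atom S C) : Fact S C := f.map GTerm.const

/-- A base instance: a finite set of base facts, that is, of atoms of constants whose predicate
is extensional. -/
structure BaseInstance (S : Schema.{u}) (C : Type v) where
  facts : Set (Atom S C)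
  finite : facts.Finite
  ext : ∀ f ∈ facts, f.pred ∈ S.ext

/-- The facts of a base instance. -/
def BaseInstance.toFacts (B : BaseInstance S C) : Facts S C := toFact '' B.facts

/-! ### Homomorphisms, triggers, models -/

/-- `σ` is a homomorphism from the set of facts `I` to the set of facts `J`. -/
def IsHom (σ : GTerm S C → GTerm S C) (I J : Facts S C) : Prop :=
  (∀ c : C, σ (GTerm.const c) = GTerm.const c) ∧ ∀ A ∈ I, A.map σ ∈ J

/-- `J ⊨ I`: there is a homomorphism from `I` into `J`. -/
def Entails (J I : Facts S C) : Prop := ∃ σ : GTerm S C → GTerm S C, IsHom σ I J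

/-- Logical equivalence of sets of facts. -/
def Equivalent (I J : Facts S C) : Prop := Entails I J ∧ Entails J I

namespace Rule

/-- The image of the `i`-th body atom under an assignment of the body variables. -/
def bodyFact (r : Rule S) (h : r.BodyVar → GTerm S C) (i : Fin r.len) : Fact S C :=
  ⟨(r.body i).pred, fun k => h ⟨(r.body i).args k, i, k, rfl⟩⟩

/-- `h` is a trigger for `r` in `I`: a homomorphism from the body of `r` into `I`. -/
def IsTrigger (r : Rule S) (I : Facts S C) (h : r.BodyVar → GTerm S C) : Prop :=
  ∀ i, r.bodyFact h i ∈ I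

open Classical in
/-- The fact `hₛ(head(r))`, where `hₛ` extends `h` by mapping every existential variable to its
fresh null. -/
noncomputable def headFact (r : Rule S) (h : r.BodyVar → GTerm S C) : Fact S C :=
  ⟨r.head.pred, fun k =>
    if hx : r.head.args k ∈ r.bodyVars then h ⟨r.head.args k, hx⟩
    else GTerm.null r h ⟨r.head.args k, ⟨k, rfl⟩, hx⟩⟩

/-- `r` holds in `I`: every trigger for `r` in `I` extends to a homomorphism from the head
into `I`. -/
def HoldsIn (r : Rule S) (I : Facts S C) : Prop :=
  ∀ h : r.BodyVar → GTerm S C, r.IsTrigger I h →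
    ∃ g : Var → GTerm S C, (∀ x : r.BodyVar, g x.1 = h x) ∧ r.head.map g ∈ I

end Rule

/-- `M` is a model of the knowledge base `(P, B)`. -/
def IsModel (P : Program S) (B M : Facts S C) : Prop :=
  B ⊆ M ∧ ∀ r ∈ P, r.HoldsIn M

/-- `M` is a universal model of `(P, B)`. -/
def IsUniversalModel (P : Program S) (B M : Facts S C) : Prop :=
  IsModel P B M ∧ ∀ M' : Facts S C, IsModel P B M' → ∃ σ, IsHom σ M M'

/-- `P` is a Finite Expansion Set: for every base instance `B` (over the constants `C`), `(P, B)`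
admits a finite universal model. -/
def IsFES (C : Type v) (P : Program S) : Prop :=
  ∀ B : BaseInstance S C, ∃ M : Facts S C, M.Finite ∧ IsUniversalModel P B.toFacts M

/-- `P` is linear: all of its rules are linear. -/
def IsLinear (P : Program S) : Prop := ∀ r ∈ P, r.IsLinear

/-! ### Boolean conjunctive queries -/

/-- A Boolean conjunctive query: a finite conjunction of atoms over constants and variables. -/
abbrev BCQ (S : Schema.{u}) (C : Type v) : Type (max u v) := List (Atom S (C ⊕ Var))

/-- `I ⊨ Q`: there is a homomorphism from the atoms of `Q` into `I`. -/
def Satisfies (I : Facts S C) (Q : BCQ S C) : Prop :=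
  ∃ σ : Var → GTerm S C, ∀ A ∈ Q, A.map (Sum.elim GTerm.const σ) ∈ I

/-- `(P, B) ⊨ Q`: every model of `(P, B)` satisfies `Q`. -/
def KBEntails (P : Program S) (B : BaseInstance S C) (Q : BCQ S C) : Prop :=
  ∀ M : Facts S C, IsModel P B.toFacts M → Satisfies M Q

/-! ### The equivalent chase -/

/-- One chase round: execute every rule with every trigger, without any check. -/
def chaseRound (P : Program S) (I : Facts S C) : Facts S C :=
  I ∪ {F | ∃ r ∈ P, ∃ h : r.BodyVar → GTerm S C, r.IsTrigger I h ∧ F = r.headFact h}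

/-- The instance computed during the `i`-th chase round. -/
def chaseStep (P : Program S) (I : Facts S C) : ℕ → Facts S C
  | 0 => I
  | i + 1 => chaseRound P (chaseStep P I i)

/-- The equivalent chase has not terminated before its `i`-th round: every one of the
rounds `1, …, i` produced an instance that is not logically equivalent to the previous one. -/
def ActiveRound (P : Program S) (I : Facts S C) (i : ℕ) : Prop :=
  ∀ j < i, ¬ Equivalent (chaseStep P I j) (chaseStep P I (j + 1))

/-- The (possibly infinite) result of the equivalent chase: the instance of the last round
before one that only yields a logically equivalent instance, or the union of all rounds if there
is no such round. -/
def chase (P : Program S) (I : Facts S C) : Facts S C :=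
  {F | ∃ i, ActiveRound P I i ∧ F ∈ chaseStep P I i}

/-- In the equivalent chase, the fact `f₂` is obtained from `f₁` (and possibly from other facts)
by executing `r`: it is newly produced in some round `i + 1` of the chase, by a trigger for `r` in
the instance of round `i` that uses `f₁`. -/
def IsExecution (P : Program S) (I : Facts S C) (f₁ : Fact S C) (r : Rule S) (f₂ : Fact S C) :
    Prop :=
  r ∈ P ∧ ∃ i, ActiveRound P I (i + 1) ∧ ∃ h : r.BodyVar → GTerm S C,
    r.IsTrigger (chaseStep P I i) h ∧ (∃ k, r.bodyFact h k = f₁) ∧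
    r.headFact h = f₂ ∧ f₂ ∉ chaseStep P I i

/-- A chase graph of the equivalent chase, given by its labelled edges `f₁ →ᵣ f₂` between facts of
the chase. Edges are rule executions by which `f₂` is obtained, and every derived fact is the target
of at least one edge. If a fact is obtained by several executions in the round in which it is
first produced, the chase graph may record any nonempty set of them. -/
structure ChaseGraph (P : Program S) (I : Facts S C) where
  edge : Fact S C → Rule S → Fact S C → Prop
  sound : ∀ f₁ r f₂, edge f₁ r f₂ → IsExecution P I f₁ r f₂
  complete : ∀ f₂ ∈ chase P I, f₂ ∉ I → ∃ f₁ r, edge f₁ r f₂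

/-- The chase graph records just one execution for each derived fact. -/
def ChaseGraph.IsSingle {P : Program S} {I : Facts S C} (E : ChaseGraph P I) : Prop :=
  ∀ f₁ r f₁' r' f₂, E.edge f₁ r f₂ → E.edge f₁' r' f₂ → f₁ = f₁' ∧ r = r'

/-! ### Execution graphs and trigger graphs -/

/-- Node- and edge-labelled digraphs: `edge u v j` is the edge `u →ⱼ v`, where `j` is a position in
the body of the rule of `v` (counted from `0`). -/
structure LabelledGraph (S : Schema.{u}) where
  Node : Type v
  rule : Node → Rule S
  edge : (x y : Node) → Fin (rule y).len → Prop

/-- `G` is an execution graph for `P`. -/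
structure IsEG (P : Program S) (G : LabelledGraph.{u, v} S) : Prop where
  rule_mem : ∀ x, G.rule x ∈ P
  acyclic : ∀ x, ¬ Relation.TransGen (fun y z => ∃ j, G.edge y z j) x x
  /-- An edge labelled `j` into `y` comes from a node whose head predicate is the `j`-th predicate
  in the body of `y`. -/
  pred_eq : ∀ x y j, G.edge x y j → (G.rule x).head.pred = ((G.rule y).body j).pred
  /-- A node whose rule is not extensional has an incoming edge for each position of its body. -/
  exists_edge : ∀ y, ¬ (G.rule y).IsExtensional → ∀ j, ∃ x, G.edge x y j

/-- Every node has at most one incoming edge for each position of its body. -/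
def LabelledGraph.AtMostOneParent (G : LabelledGraph.{u, v} S) : Prop :=
  ∀ x x' y j, G.edge x y j → G.edge x' y j → x = x'

/-- `G.NodeFact B x F` says that `F ∈ x(B)`: the reasoning over `B` guided by `G`. -/
inductive LabelledGraph.NodeFact {C : Type*} (G : LabelledGraph S) (B : Facts S C) :
    G.Node → Fact S C → Prop where
  | ext (x : G.Node) (h : (G.rule x).BodyVar → GTerm S C)
      (hx : (G.rule x).IsExtensional) (hB : (G.rule x).IsTrigger B h) :
      G.NodeFact B x ((G.rule x).headFact h)
  | int (x : G.Node) (h : (G.rule x).BodyVar → GTerm S C)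
      (hx : ¬ (G.rule x).IsExtensional) (y : Fin (G.rule x).len → G.Node)
      (hy : ∀ i, G.edge (y i) x i)
      (hh : ∀ i, G.NodeFact B (y i) ((G.rule x).bodyFact h i)) :
      G.NodeFact B x ((G.rule x).headFact h)

/-- `G(B) = B ∪ ⋃ₓ x(B)`. -/
def LabelledGraph.eval {C : Type*} (G : LabelledGraph S) (B : Facts S C) : Facts S C :=
  B ∪ {F | ∃ x, G.NodeFact B x F}

/-- `G` is a trigger graph for `(P, B)`. -/
def IsTGForKB {C : Type*} (P : Program S) (B : BaseInstance S C) (G : LabelledGraph S) : Prop :=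
  IsEG P G ∧ ∀ Q : BCQ S C, KBEntails P B Q ↔ Satisfies (G.eval B.toFacts) Q

/-- `G` is an (instance-independent) trigger graph for `P`. -/
def IsTG (C : Type*) (P : Program S) (G : LabelledGraph S) : Prop :=
  ∀ B : BaseInstance S C, IsTGForKB P B G

/-! ### The graph computed for a linear program -/

/-- Pattern-isomorphic atoms of constants: they have the same predicate and a bijection between
their constants maps one to the other. -/
def PatternIso (f f' : Atom S C) : Prop :=
  ∃ g : C → C, Set.BijOn g f.terms f'.terms ∧ f.map g = f'

/-- `f` is a base fact over an extensional predicate that occurs in the program `P`. -/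
def IsBaseFactOf (P : Program S) (f : Atom S C) : Prop :=
  f.pred ∈ S.ext ∧ ∃ r ∈ P, ∃ i, (r.body i).pred = f.pred

/-- `H` is a possible choice of `ℋ(P)`: it contains exactly one representative of each class of
pattern-isomorphic base facts over the extensional predicates in `P`. -/
structure IsPatternSet (P : Program S) (H : Set (Atom S C)) : Prop where
  base : ∀ f ∈ H, IsBaseFactOf P f
  not_iso : ∀ f ∈ H, ∀ f' ∈ H, PatternIso f f' → f = f'
  cover : ∀ f : Atom S C, IsBaseFactOf P f → ∃ f' ∈ H, PatternIso f f'

/-- The nodes that the algorithm creates: for each `f ∈ H`, a fresh one for each edge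
`src →ᵣ tgt` of the chase graph of `(P, {f})`. -/
structure TNode (P : Program S) (H : Set (Atom S C))
    (E : (f : Atom S C) → ChaseGraph P ({toFact f} : Facts S C)) where
  origin : Atom S C
  origin_mem : origin ∈ H
  src : Fact S C
  rule : Rule S
  tgt : Fact S C
  is_edge : (E origin).edge src rule tgt

/-- The graph `tgraphLinear(P)`, computed from the representatives `H` and the chase graphs `E`.
It is the disjoint union of graphs `Γ`, one for each `f ∈ H`; in `Γ` there is an edge, labelled with
the first body position, from the node of `f₁ →ᵣ f₂` to the node of `f₂ →ᵣ' f₃`. -/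
def tgraphLinear (P : Program S) (H : Set (Atom S C))
    (E : (f : Atom S C) → ChaseGraph P ({toFact f} : Facts S C)) : LabelledGraph S where
  Node := TNode P H E
  rule := TNode.rule
  edge x y j := x.origin = y.origin ∧ x.tgt = y.src ∧ (j : ℕ) = 0

end TrigGraph

namespace TrigGraph

universe u v

variable {S : Schema.{u}} {C : Type v}

/-! ### Atoms, heads and bodies -/

/-! Both directions compare `G(B)` with the unrestricted chase `chaseLimit P B`, which is a model
mapping into every model. Soundness is the inclusion of `G(B)` in this chase.

Completeness needs a homomorphism from the chase into `G(B)`. By linearity every fact of the chase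
descends from a single fact of `B`, and a null determines which facts of `B` the facts containing it
descend from; so homomorphisms defined on the chases of the single facts glue
(`entails_chaseLimit_of_forall`). For one fact `f`, a finite universal model of its representative
forces the equivalent chase of the representative to stop at a round into which the whole chase maps
(`exists_activeRound_entails`). The nodes of the graph replay that round with the constants renamed
back to those of `f` (`exists_nodeFact`), and conjugating by the renaming carries the homomorphism
over to `f` (`Entails.chaseLimit_of_rename`).

Acyclicity holds because facts along a path are born in strictly later rounds. -/

theorem Atom.map_map {T T' T'' : Type*} (g : T → T') (g' : T' → T'') (A : Atom S T) :
    (A.map g).map g' = A.map (fun t => g' (g t)) := rfl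

theorem Atom.map_congr {T T' : Type*} {g g' : T → T'} {A : Atom S T}
    (h : ∀ t ∈ A.terms, g t = g' t) : A.map g = A.map g' := by
  cases A with
  | mk p a =>
    simp only [Atom.map, Atom.mk.injEq, heq_eq_eq, true_and]
    funext k
    exact h _ ⟨k, rfl⟩

theorem toFact_map {σ : GTerm S C → GTerm S C} (hσ : ∀ c, σ (.const c) = .const c)
    (f : Atom S C) : (toFact f).map σ = toFact f :=
  show f.map (fun c => σ (.const c)) = f.map GTerm.const by simp only [hσ]

theorem Entails.trans {I J K : Facts S C} (h : Entails K J) (h' : Entails J I) :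
    Entails K I := by
  obtain ⟨σ, hσ, hσ'⟩ := h
  obtain ⟨τ, hτ, hτ'⟩ := h'
  exact ⟨fun t => σ (τ t), fun c => (congrArg σ (hτ c)).trans (hσ c), fun A hA => hσ' _ (hτ' A hA)⟩

theorem Entails.of_subset {I J : Facts S C} (h : I ⊆ J) : Entails J I :=
  ⟨id, fun _ => rfl, fun _ hA => h hA⟩

theorem Satisfies.of_entails {I J : Facts S C} {Q : BCQ S C} (h : Entails J I)
    (hQ : Satisfies I Q) : Satisfies J Q := by
  obtain ⟨τ, hτ, hτ'⟩ := h
  obtain ⟨σ, hσ⟩ := hQ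
  refine ⟨fun x => τ (σ x), fun A hA => ?_⟩
  have h := hτ' _ (hσ A hA)
  rw [Atom.map_map] at h
  convert h using 2
  funext t
  cases t <;> simp [hτ]

namespace Rule

theorem exists_mem_bodyFact_terms (r : Rule S) (h : r.BodyVar → GTerm S C) (x : r.BodyVar) :
    ∃ k, h x ∈ (r.bodyFact h k).terms := by
  obtain ⟨x, i, k, rfl⟩ := x
  exact ⟨i, k, rfl⟩

theorem mem_headFact_terms {r : Rule S} {h : r.BodyVar → GTerm S C} {t : GTerm S C}
    (ht : t ∈ (r.headFact h).terms) :
    (∃ k, t ∈ (r.bodyFact h k).terms) ∨ ∃ z, t = .null r h z := by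
  obtain ⟨k, rfl⟩ := ht
  simp only [headFact]
  split_ifs with hx
  · exact .inl (r.exists_mem_bodyFact_terms h _)
  · exact .inr ⟨_, rfl⟩

theorem headFact_map {D : Type*} {r : Rule S} {h : r.BodyVar → GTerm S C}
    {h' : r.BodyVar → GTerm S D} {σ : GTerm S C → GTerm S D} (hh : ∀ x, σ (h x) = h' x)
    (hz : ∀ z, σ (.null r h z) = .null r h' z) : (r.headFact h).map σ = r.headFact h' := by
  simp only [headFact, Atom.map, Atom.mk.injEq, heq_eq_eq, true_and]
  funext k
  split_ifs with hx
  · exact hh _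
  · exact hz _

theorem not_isExtensional_of_int {r : Rule S} (k : Fin r.len) (hk : (r.body k).pred ∈ S.int) :
    ¬ r.IsExtensional := fun h => Set.disjoint_left.1 S.disj (h k) hk

theorem isExtensional_of_mem {r : Rule S} (k : Fin r.len) (hk : (r.body k).pred ∈ S.ext) :
    r.IsExtensional :=
  r.body_uniform.resolve_right fun h => Set.disjoint_left.1 S.disj hk (h k)

theorem IsLinear.subsingleton {r : Rule S} (hr : r.IsLinear) : Subsingleton (Fin r.len) := by
  have : r.len = 1 := hr
  rw [this]
  infer_instance

end Rule

/-! ### The chase without termination check -/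

/-- The union of all chase rounds. -/
def chaseLimit (P : Program S) (I : Facts S C) : Facts S C := {F | ∃ i, F ∈ chaseStep P I i}

theorem chaseStep_mono (P : Program S) (I : Facts S C) : Monotone (chaseStep P I) :=
  monotone_nat_of_le_succ fun _ => Set.subset_union_left

theorem headFact_mem_chaseStep {P : Program S} {I : Facts S C} {i : ℕ} {r : Rule S} (hr : r ∈ P)
    {h : r.BodyVar → GTerm S C} (ht : r.IsTrigger (chaseStep P I i) h) :
    r.headFact h ∈ chaseStep P I (i + 1) := .inr ⟨r, hr, h, ht, rfl⟩

theorem exists_chaseStep_of_subset {P : Program S} {I J : Facts S C} (hJ : J.Finite)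
    (h : J ⊆ chaseLimit P I) : ∃ i, J ⊆ chaseStep P I i := by
  choose! n hn using h
  obtain ⟨m, hm⟩ := (hJ.image n).bddAbove
  exact ⟨m, fun F hF => chaseStep_mono P I (hm ⟨F, hF, rfl⟩) (hn hF)⟩

theorem headFact_mem_chaseLimit {P : Program S} {I : Facts S C} {r : Rule S} (hr : r ∈ P)
    {h : r.BodyVar → GTerm S C} (ht : r.IsTrigger (chaseLimit P I) h) :
    r.headFact h ∈ chaseLimit P I := by
  obtain ⟨i, hi⟩ := exists_chaseStep_of_subset (Set.finite_range (r.bodyFact h))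
    (Set.range_subset_iff.2 ht)
  exact ⟨i + 1, headFact_mem_chaseStep hr fun k => hi ⟨k, rfl⟩⟩

theorem chaseLimit_induction {P : Program S} {I : Facts S C} {p : Fact S C → Prop}
    (base : ∀ F ∈ I, p F)
    (step : ∀ r ∈ P, ∀ h : r.BodyVar → GTerm S C, r.IsTrigger (chaseLimit P I) h →
      (∀ k, p (r.bodyFact h k)) → p (r.headFact h)) :
    ∀ F ∈ chaseLimit P I, p F := by
  rintro F ⟨i, hi⟩
  induction i generalizing F with
  | zero => exact base F hi
  | succ i ih =>
    rcases hi with hi | ⟨r, hr, h, ht, rfl⟩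
    · exact ih F hi
    · exact step r hr h (fun k => ⟨i, ht k⟩) fun k => ih _ (ht k)

theorem isModel_chaseLimit [Nonempty (GTerm S C)] (P : Program S) (I : Facts S C) :
    IsModel P I (chaseLimit P I) := by
  classical
  refine ⟨fun F hF => ⟨0, hF⟩, fun r hr h ht => ?_⟩
  refine ⟨fun x => if hx : x ∈ r.bodyVars then h ⟨x, hx⟩
    -- Extensions are total on `Var`, so variables absent from the rule need a junk value; hence the
    -- `Nonempty` assumption.
    else if hx' : x ∈ r.head.terms then .null r h ⟨x, hx', hx⟩ else Classical.arbitrary _,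
    fun x => dif_pos x.2, ?_⟩
  convert headFact_mem_chaseLimit hr ht using 1
  simp only [Rule.headFact, Atom.map, Atom.mk.injEq, heq_eq_eq, true_and]
  funext k
  split_ifs with h1 h2
  · rfl
  · rfl
  · exact absurd ⟨k, rfl⟩ h2

open Classical in
/-- The image in a model `M` of the null for `z`, once the body of `r` is mapped into `M`
by `h`. -/
noncomputable def nullImage (M : Facts S C) (r : Rule S) (h : r.BodyVar → GTerm S C)
    (z : r.ExVar) : GTerm S C :=
  if H : ∃ g : Var → GTerm S C, (∀ x : r.BodyVar, g x.1 = h x) ∧ r.head.map g ∈ M then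
    H.choose z.1
  else .null r h z

/-- The canonical term mapping from the chase into a model. -/
noncomputable def toModel (M : Facts S C) : GTerm S C → GTerm S C
  | .const c => .const c
  | .null r h z => nullImage M r (fun x => toModel M (h x)) z

/-- Once the body of a trigger is mapped into `M`, all nulls of its head take their values from the
same chosen extension, so the head lands in `M` as well. -/
theorem IsModel.entails_chaseLimit {P : Program S} {I M : Facts S C} (hM : IsModel P I M)
    (hI : I ⊆ Set.range toFact) : Entails M (chaseLimit P I) := by
  refine ⟨toModel M, fun c => by rw [toModel], chaseLimit_induction ?_ ?_⟩
  · intro F hF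
    obtain ⟨f, rfl⟩ := hI hF
    rw [toFact_map fun c => by rw [toModel]]
    exact hM.1 hF
  · intro r hr h _ hk
    have H := hM.2 r hr (fun x => toModel M (h x)) hk
    convert H.choose_spec.2 using 1
    simp only [Rule.headFact, Atom.map, Atom.mk.injEq, heq_eq_eq, true_and]
    funext k
    split_ifs with hx
    · exact (H.choose_spec.1 ⟨_, hx⟩).symm
    · exact dif_pos H

/-- A null encodes the trigger that invents it, and it can enter the chase only through the head
fact of that trigger. -/
theorem headFact_mem_of_null_mem_chaseStep {P : Program S} {I : Facts S C}
    (hI : I ⊆ Set.range toFact) {r : Rule S} {h : r.BodyVar → GTerm S C} {z : r.ExVar} {i : ℕ}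
    {F : Fact S C} (hF : F ∈ chaseStep P I i) (hz : GTerm.null r h z ∈ F.terms) :
    r.headFact h ∈ chaseStep P I i := by
  induction i generalizing F with
  | zero =>
    obtain ⟨f, rfl⟩ := hI hF
    obtain ⟨k, hk⟩ := hz
    cases hk
  | succ i ih =>
    rcases hF with hF | ⟨r', hr', h', ht, rfl⟩
    · exact .inl (ih hF hz)
    · rcases Rule.mem_headFact_terms hz with ⟨k, hk⟩ | ⟨z', hz'⟩
      · exact .inl (ih (ht k) hk)
      · cases hz'
        exact headFact_mem_chaseStep hr' ht

theorem headFact_mem_of_null_mem_chaseLimit {P : Program S} {I : Facts S C}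
    (hI : I ⊆ Set.range toFact) {r : Rule S} {h : r.BodyVar → GTerm S C} {z : r.ExVar}
    {F : Fact S C} (hF : F ∈ chaseLimit P I) (hz : GTerm.null r h z ∈ F.terms) :
    r.headFact h ∈ chaseLimit P I :=
  hF.imp fun _ hi => headFact_mem_of_null_mem_chaseStep hI hi hz

theorem mem_terms_of_const_mem {P : Program S} {f : Atom S C} {c : C} :
    ∀ F ∈ chaseLimit P {toFact f}, GTerm.const c ∈ F.terms → c ∈ f.terms := by
  refine chaseLimit_induction ?_ ?_
  · rintro _ rfl ⟨k, hk⟩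
    cases hk
    exact ⟨k, rfl⟩
  · intro r _ h _ hk hc
    rcases Rule.mem_headFact_terms hc with ⟨k, h'⟩ | ⟨z, hz⟩
    · exact hk k h'
    · cases hz

/-! ### Termination of the equivalent chase -/

/-- Old nulls keep their image under `σ`; a new null follows its trigger, from `h` to `σ ∘ h`. The
assumption `hI` prevents a clash: nulls of a head fact outside `I` do not occur in `I`. -/
theorem Entails.chaseRound {P : Program S} {I J : Facts S C} (hIJ : Entails J I)
    (hI : ∀ (r : Rule S) (h : r.BodyVar → GTerm S C) (z : r.ExVar), ∀ F ∈ I,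
      GTerm.null r h z ∈ F.terms → r.headFact h ∈ I) :
    Entails (chaseRound P J) (chaseRound P I) := by
  classical
  obtain ⟨σ, hσ, hσ'⟩ := hIJ
  let τ : GTerm S C → GTerm S C
    | .const c => .const c
    | .null r h z => if ∃ F ∈ I, GTerm.null r h z ∈ F.terms then σ (.null r h z)
      else .null r (fun x => σ (h x)) z
  have hτ : ∀ F ∈ I, ∀ t ∈ F.terms, τ t = σ t := by
    intro F hF t ht
    cases t with
    | const c => exact (hσ c).symm
    | null r h z => exact if_pos ⟨F, hF, ht⟩
  have hτ' : ∀ F ∈ I, F.map τ ∈ J := fun F hF => by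
    rw [Atom.map_congr (hτ F hF)]
    exact hσ' F hF
  refine ⟨τ, fun _ => rfl, ?_⟩
  rintro F (hF | ⟨r, hr, h, ht, rfl⟩)
  · exact .inl (hτ' F hF)
  · by_cases hF : r.headFact h ∈ I
    · exact .inl (hτ' _ hF)
    · refine .inr ⟨r, hr, fun x => σ (h x), fun k => hσ' _ (ht k), Rule.headFact_map ?_ ?_⟩
      · intro x
        obtain ⟨k, hk⟩ := r.exists_mem_bodyFact_terms h x
        exact hτ _ (ht k) _ hk
      · exact fun z => if_neg fun ⟨F, hF', hz⟩ => hF (hI r h z F hF' hz)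

theorem entails_chaseStep_of_entails_succ {P : Program S} {I : Facts S C}
    (hI : I ⊆ Set.range toFact) {k : ℕ}
    (hk : Entails (chaseStep P I k) (chaseStep P I (k + 1))) {j : ℕ} (hj : k ≤ j) :
    Entails (chaseStep P I k) (chaseStep P I j) := by
  induction j, hj using Nat.le_induction with
  | base => exact .of_subset subset_rfl
  | succ j _ ih =>
    exact hk.trans (ih.chaseRound fun _ _ _ _ => headFact_mem_of_null_mem_chaseStep hI)

/-- The chase maps into `U`, and `U` maps onto a finite part of the chase, hence into some round
`j`. So round `j` absorbs the whole chase, and the first stable round `k ≤ j` absorbs round `j`. -/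
theorem exists_activeRound_entails [Nonempty (GTerm S C)] {P : Program S} {I U : Facts S C}
    (hI : I ⊆ Set.range toFact) (hfin : U.Finite) (hU : IsUniversalModel P I U) :
    ∃ k, ActiveRound P I k ∧ Entails (chaseStep P I k) (chaseLimit P I) := by
  classical
  obtain ⟨σ, hσ, hσ'⟩ := hU.2 _ (isModel_chaseLimit P I)
  obtain ⟨j, hj⟩ := exists_chaseStep_of_subset (hfin.image (Atom.map σ))
    (Set.image_subset_iff.2 hσ')
  have hUj : Entails (chaseStep P I j) (chaseLimit P I) :=
    Entails.trans ⟨σ, hσ, fun A hA => hj ⟨A, hA, rfl⟩⟩ (hU.1.entails_chaseLimit hI)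
  have hex : ∃ k, Equivalent (chaseStep P I k) (chaseStep P I (k + 1)) :=
    ⟨j, hUj.trans (.of_subset fun F hF => ⟨_, hF⟩),
      .of_subset (chaseStep_mono P I j.le_succ)⟩
  exact ⟨Nat.find hex, fun i hi => Nat.find_min hex hi,
    (entails_chaseStep_of_entails_succ hI (Nat.find_spec hex).1
      (Nat.find_min' hex ⟨hUj.trans (.of_subset fun F hF => ⟨_, hF⟩),
        .of_subset (chaseStep_mono P I j.le_succ)⟩)).trans hUj⟩

/-! ### Renaming constants -/

/-- Rename the constants of a term. -/
def GTerm.mapConst (g : C → C) : GTerm S C → GTerm S C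
  | .const c => .const (g c)
  | .null r h z => .null r (fun x => GTerm.mapConst g (h x)) z

theorem headFact_mapConst (g : C → C) (r : Rule S) (h : r.BodyVar → GTerm S C) :
    (r.headFact h).map (GTerm.mapConst g) = r.headFact fun x => (h x).mapConst g :=
  Rule.headFact_map (fun _ => rfl) fun _ => by rw [GTerm.mapConst]

theorem toFact_mapConst (g : C → C) (f : Atom S C) :
    (toFact f).map (GTerm.mapConst g) = toFact (f.map g) :=
  show f.map (fun c => GTerm.mapConst g (.const c)) = f.map (fun c => .const (g c)) by
    simp only [GTerm.mapConst]

/-- Rules are constant-free, so renaming commutes with firing them; `g` need not be injective. -/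
theorem mapConst_mem_chaseLimit {P : Program S} {f : Atom S C} (g : C → C) :
    ∀ F ∈ chaseLimit P {toFact f}, F.map (GTerm.mapConst g) ∈ chaseLimit P {toFact (f.map g)} := by
  refine chaseLimit_induction ?_ ?_
  · rintro _ rfl
    exact ⟨0, toFact_mapConst g f⟩
  · intro r hr h _ hk
    rw [headFact_mapConst]
    exact headFact_mem_chaseLimit hr hk

theorem Entails.chaseLimit_of_rename {P : Program S} {f : Atom S C} {g g' : C → C}
    (hg : ∀ c ∈ f.terms, g' (g c) = c) {J K : Facts S C}
    (hJ : Entails J (chaseLimit P {toFact (f.map g)}))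
    (hK : ∀ F ∈ J, F.map (GTerm.mapConst g') ∈ K) : Entails K (chaseLimit P {toFact f}) := by
  obtain ⟨σ, hσ, hσ'⟩ := hJ
  -- Conjugation of `σ` by the renaming, corrected to fix all constants: `g'` inverts `g` only on
  -- the constants of `f`, but no others occur in this chase.
  let τ : GTerm S C → GTerm S C
    | .const c => .const c
    | .null r h z => (σ ((GTerm.null r h z).mapConst g)).mapConst g'
  refine ⟨τ, fun _ => rfl, fun F hF => ?_⟩
  have h : F.map τ = F.map fun t => (σ (t.mapConst g)).mapConst g' := by
    refine Atom.map_congr fun t ht => ?_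
    cases t with
    | const c =>
      simp only [τ, GTerm.mapConst, hσ, hg c (mem_terms_of_const_mem F hF ht)]
    | null r h z => rfl
  rw [h]
  exact hK _ (hσ' _ (mapConst_mem_chaseLimit g F hF))

/-! ### Linear programs: the chase of an instance and the chases of its facts -/

theorem exists_mem_chaseLimit_singleton {P : Program S} (hP : IsLinear P) {I : Facts S C} :
    ∀ F ∈ chaseLimit P I, ∃ A ∈ I, F ∈ chaseLimit P {A} := by
  refine chaseLimit_induction (fun F hF => ⟨F, hF, 0, rfl⟩) ?_
  intro r hr h _ hk
  obtain ⟨A, hA, hF⟩ := hk ⟨0, r.len_pos⟩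
  have := (hP r hr).subsingleton
  exact ⟨A, hA, headFact_mem_chaseLimit hr fun k => Subsingleton.elim k _ ▸ hF⟩

/-- In the linear case, a null determines from which facts the facts that contain it can be
derived. -/
theorem mem_chaseLimit_of_null_mem {P : Program S} (hP : IsLinear P) {I J : Facts S C}
    (hI : I ⊆ Set.range toFact) (hJ : J ⊆ Set.range toFact) {r : Rule S}
    {h : r.BodyVar → GTerm S C} {z : r.ExVar} {A : Fact S C} (hA : A ∈ chaseLimit P I)
    (hz : GTerm.null r h z ∈ A.terms) :
    ∀ F ∈ chaseLimit P J, GTerm.null r h z ∈ F.terms → F ∈ chaseLimit P I := by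
  refine chaseLimit_induction ?_ ?_
  · rintro F hF ⟨k, hk⟩
    obtain ⟨f, rfl⟩ := hJ hF
    cases hk
  · intro r' hr' h' _ hk hz'
    -- Either the null is inherited from the only body atom, or the fact is the very head fact that
    -- invents it.
    rcases Rule.mem_headFact_terms hz' with ⟨k, h''⟩ | ⟨z', hz''⟩
    · have := (hP r' hr').subsingleton
      exact headFact_mem_chaseLimit hr' fun l => Subsingleton.elim k l ▸ hk k h''
    · cases hz''
      exact headFact_mem_of_null_mem_chaseLimit hI hA hz

theorem entails_chaseLimit_of_forall {P : Program S} (hP : IsLinear P) {I K : Facts S C}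
    (hI : I ⊆ Set.range toFact) (hK : ∀ A ∈ I, Entails K (chaseLimit P {A})) :
    Entails K (chaseLimit P I) := by
  classical
  have : Nonempty (GTerm S C → GTerm S C) := ⟨id⟩
  choose! τ hτ hτ' using hK
  have hsub : ∀ A ∈ I, ({A} : Facts S C) ⊆ Set.range toFact := fun A hA =>
    Set.singleton_subset_iff.2 (hI hA)
  let Or : GTerm S C → Set (Fact S C) := fun t =>
    {A | A ∈ I ∧ ∃ F ∈ chaseLimit P {A}, t ∈ F.terms}
  -- The choice depends only on the set of origins. All nulls of a fact `F` have the same origins as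
  -- `F`, so one `τ` serves the whole of `F`.
  let pick : Set (Fact S C) → GTerm S C → GTerm S C := fun s =>
    if hs : s.Nonempty then τ hs.choose else id
  let σ : GTerm S C → GTerm S C
    | .const c => .const c
    | .null r h z => pick (Or (.null r h z)) (.null r h z)
  refine ⟨σ, fun _ => rfl, fun F hF => ?_⟩
  have hne : {A | A ∈ I ∧ F ∈ chaseLimit P {A}}.Nonempty :=
    exists_mem_chaseLimit_singleton hP F hF
  obtain ⟨hA, hFA⟩ := hne.choose_spec
  suffices h : F.map σ = F.map (τ hne.choose) by
    rw [h]
    exact hτ' _ hA F hFA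
  refine Atom.map_congr fun t ht => ?_
  cases t with
  | const c => exact (hτ _ hA c).symm
  | null r h z =>
    have hOr : Or (.null r h z) = {A | A ∈ I ∧ F ∈ chaseLimit P {A}} := by
      ext A
      refine and_congr_right fun hA => ⟨fun ⟨F', hF', hz⟩ => ?_, fun hF' => ⟨F, hF', ht⟩⟩
      exact mem_chaseLimit_of_null_mem hP (hsub A hA) hI hF' hz F hF ht
    show pick (Or (.null r h z)) _ = _
    rw [hOr]
    simp only [pick, dif_pos hne]

/-! ### The graph of a linear program -/

section Graph

variable {P : Program S} {H : Set (Atom S C)}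
  {E : (f : Atom S C) → ChaseGraph P ({toFact f} : Facts S C)}

theorem ActiveRound.mono {I : Facts S C} {i j : ℕ} (hij : i ≤ j) (hj : ActiveRound P I j) :
    ActiveRound P I i := fun k hk => hj k (hk.trans_le hij)

theorem TNode.body_pred (hP : IsLinear P) (x : TNode P H E) (k : Fin x.rule.len) :
    (x.rule.body k).pred = x.src.pred := by
  obtain ⟨hr, _, _, h, _, ⟨k', hk'⟩, _⟩ := (E x.origin).sound _ _ _ x.is_edge
  have := (hP _ hr).subsingleton
  rw [← hk', Subsingleton.elim k k']
  rfl

/-- Taking `x = y` gives acyclicity. Each edge leads to a strictly later birth round, since a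
trigger uses facts present before its result. -/
theorem TNode.exists_round {x y : TNode P H E}
    (hxy : Relation.TransGen (fun y z => ∃ j, (tgraphLinear P H E).edge y z j) x y) :
    x.origin = y.origin ∧ ∃ i, x.tgt ∈ chaseStep P {toFact x.origin} i ∧
      y.tgt ∉ chaseStep P {toFact x.origin} i := by
  have step : ∀ y z : TNode P H E, (∃ j, (tgraphLinear P H E).edge y z j) →
      y.origin = z.origin ∧ ∃ i, y.tgt ∈ chaseStep P {toFact y.origin} i ∧
        z.tgt ∉ chaseStep P {toFact y.origin} i := by
    rintro y z ⟨-, ho, ht, -⟩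
    obtain ⟨hr, i, -, h, htr, ⟨k, hk⟩, -, hn⟩ := (E z.origin).sound _ _ _ z.is_edge
    rw [ho, ht, ← hk]
    exact ⟨rfl, i, htr k, hn⟩
  induction hxy with
  | single h => exact step _ _ h
  | tail _ h ih =>
    obtain ⟨ho, i, hi, hi'⟩ := ih
    obtain ⟨ho', j, hj, hj'⟩ := step _ _ h
    rw [← ho] at hj hj'
    refine ⟨ho.trans ho', j, chaseStep_mono P _ ?_ hi, hj'⟩
    by_contra hji
    exact hi' (chaseStep_mono P _ (le_of_not_ge hji) hj)

theorem isEG_tgraphLinear (hP : IsLinear P) (hH : ∀ f ∈ H, f.pred ∈ S.ext) :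
    IsEG P (tgraphLinear P H E) where
  rule_mem x := ((E x.origin).sound _ _ _ x.is_edge).1
  acyclic x hx := by
    obtain ⟨-, i, hi, hi'⟩ := TNode.exists_round hx
    exact hi' hi
  pred_eq := by
    rintro x y j ⟨-, ht, -⟩
    obtain ⟨_, _, _, h, _, _, hh, _⟩ := (E x.origin).sound _ _ _ x.is_edge
    exact (congrArg Atom.pred (hh.trans ht)).trans (TNode.body_pred hP y j).symm
  exists_edge := by
    intro y hy j
    obtain ⟨hr, i, hact, h, htr, ⟨k, hk⟩, -, -⟩ := (E y.origin).sound _ _ _ y.is_edge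
    -- A non-extensional rule cannot fire on the base fact, so the source is derived and has a
    -- recorded execution, which is the parent node.
    have hsrc : y.src ∉ ({toFact y.origin} : Facts S C) := by
      intro hs
      refine hy (Rule.isExtensional_of_mem k ?_)
      have hpred : (y.rule.body k).pred = y.origin.pred :=
        (TNode.body_pred hP y k).trans (congrArg Atom.pred (Set.mem_singleton_iff.1 hs))
      exact Set.mem_of_eq_of_mem hpred (hH _ y.origin_mem)
    obtain ⟨f₁, r, he⟩ := (E y.origin).complete y.src
      ⟨i, hact.mono i.le_succ, hk ▸ htr k⟩ hsrc
    have : Subsingleton (Fin y.rule.len) := (hP _ hr).subsingleton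
    exact ⟨⟨y.origin, y.origin_mem, f₁, r, y.src, he⟩, rfl, rfl,
      congrArg Fin.val (this.elim j ⟨0, y.rule.len_pos⟩)⟩

theorem atMostOneParent_tgraphLinear (hE : ∀ f ∈ H, (E f).IsSingle) :
    (tgraphLinear P H E).AtMostOneParent := by
  rintro ⟨o, ho, s, r, t, he⟩ ⟨o', ho', s', r', t', he'⟩ y j ⟨h1, h2, -⟩ ⟨h1', h2', -⟩
  dsimp only at h1 h2 h1' h2'
  subst h1 h2 h1' h2'
  obtain ⟨rfl, rfl⟩ := hE _ ho _ _ _ _ _ he he'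
  rfl

theorem LabelledGraph.eval_subset_chaseLimit {G : LabelledGraph S} (hG : ∀ x, G.rule x ∈ P)
    (B : Facts S C) : G.eval B ⊆ chaseLimit P B := by
  rintro F (hF | ⟨x, hF⟩)
  · exact ⟨0, hF⟩
  · induction hF with
    | ext x h _ hB => exact headFact_mem_chaseLimit (hG x) fun k => ⟨0, hB k⟩
    | int x h _ y _ _ ih => exact headFact_mem_chaseLimit (hG x) ih

/-- Recursion on rounds: a recorded edge into `F` comes from a fact of an earlier round, which is
either `f` itself or computed by a node that then serves as parent. -/
theorem exists_nodeFact (hP : IsLinear P) {f : Atom S C} (hf : f ∈ H) (hext : f.pred ∈ S.ext)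
    {g : C → C} {B : Facts S C} (hB : toFact (f.map g) ∈ B) {i : ℕ}
    (hi : ActiveRound P {toFact f} i) {F : Fact S C} (hF : F ∈ chaseStep P {toFact f} i)
    (hne : F ≠ toFact f) :
    ∃ x : TNode P H E, x.origin = f ∧ x.tgt = F ∧
      (tgraphLinear P H E).NodeFact B x (F.map (GTerm.mapConst g)) := by
  induction i using Nat.strong_induction_on generalizing F with
  | _ i ih =>
    obtain ⟨f₁, r, he⟩ := (E f).complete F ⟨i, hi, hF⟩ hne
    obtain ⟨hr, j, hact, h, htr, ⟨k, rfl⟩, rfl, hn⟩ := (E f).sound _ _ _ he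
    have hji : j < i := by
      by_contra hij
      exact hn (chaseStep_mono P _ (not_lt.1 hij) hF)
    let x : TNode P H E := ⟨f, hf, r.bodyFact h k, r, r.headFact h, he⟩
    refine ⟨x, rfl, rfl, ?_⟩
    have := (hP r hr).subsingleton
    rw [headFact_mapConst]
    by_cases hsrc : r.bodyFact h k = toFact f
    · refine .ext (G := tgraphLinear P H E) x _
        (Rule.isExtensional_of_mem k ((congrArg Atom.pred hsrc).symm ▸ hext :)) fun l => ?_
      rw [← toFact_mapConst, ← hsrc, Subsingleton.elim k l] at hB
      exact hB
    · obtain ⟨y, hyo, hyt, hy⟩ := ih j hji (hact.mono j.le_succ) (htr k) hsrc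
      have hint : (r.body k).pred ∈ S.int := by
        obtain ⟨_, _, _, h', _, _, hh, _⟩ := (E y.origin).sound _ _ _ y.is_edge
        have := congrArg Atom.pred (hh.trans hyt)
        exact (this : y.rule.head.pred = _) ▸ y.rule.head_int
      refine .int (G := tgraphLinear P H E) x _ (Rule.not_isExtensional_of_int k hint)
        (fun _ => y) (fun l => ⟨hyo, hyt, ?_⟩) fun l => ?_
      · exact congrArg Fin.val (this.elim l ⟨0, r.len_pos⟩)
      · rw [Subsingleton.elim k l] at hy
        exact hy

/-- Covers the facts without a representative in `H`: no rule fires on them. -/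
theorem chaseLimit_singleton_of_not_isBaseFactOf {f : Atom S C} (hext : f.pred ∈ S.ext)
    (hf : ¬ IsBaseFactOf P f) : chaseLimit P {toFact f} ⊆ {toFact f} :=
  chaseLimit_induction (fun _ hF => hF) fun r hr _ _ hk =>
    absurd ⟨hext, r, hr, ⟨0, r.len_pos⟩, congrArg Atom.pred (hk ⟨0, r.len_pos⟩)⟩ hf

theorem entails_eval_chaseLimit_singleton [Nonempty (GTerm S C)] (hP : IsLinear P)
    (hfes : IsFES C P) (hH : IsPatternSet P H) {B : Facts S C} {f : Atom S C}
    (hB : toFact f ∈ B) (hext : f.pred ∈ S.ext) :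
    Entails ((tgraphLinear P H E).eval B) (chaseLimit P {toFact f}) := by
  by_cases hf : IsBaseFactOf P f
  swap
  · exact .of_subset ((chaseLimit_singleton_of_not_isBaseFactOf hext hf).trans
      (Set.singleton_subset_iff.2 (.inl hB)))
  obtain ⟨_, hf', g, hg, rfl⟩ := hH.cover f hf
  obtain ⟨g', hg'⟩ : ∃ g' : C → C, ∀ c ∈ f.terms, g' (g c) = c := by
    rcases isEmpty_or_nonempty C with hC | hC
    · exact ⟨id, fun c => hC.elim c⟩
    · exact ⟨Function.invFunOn g f.terms, hg.injOn.leftInvOn_invFunOn⟩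
  have hback : (f.map g).map g' = f :=
    (Atom.map_map g g' f).trans (Atom.map_congr (g' := id) hg')
  obtain ⟨U, hfin, hU⟩ := hfes ⟨{f.map g}, Set.finite_singleton _, by rintro _ rfl; exact hext⟩
  simp only [BaseInstance.toFacts, Set.image_singleton] at hU
  obtain ⟨k, hk, hent⟩ := exists_activeRound_entails
    (Set.singleton_subset_iff.2 ⟨_, rfl⟩) hfin hU
  refine hent.chaseLimit_of_rename hg' fun F hF => ?_
  by_cases hne : F = toFact (f.map g)
  · rw [hne, toFact_mapConst, hback]
    exact .inl hB
  -- Here the representative is `f.map g`, and the replay renames by `g'`, back to `f`.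
  · obtain ⟨x, -, -, hx⟩ := exists_nodeFact (E := E) hP hf' hext (hback.symm ▸ hB) hk hF hne
    exact .inr ⟨x, hx⟩

theorem kbEntails_iff_satisfies_eval (hP : IsLinear P) (hfes : IsFES C P)
    (hH : IsPatternSet P H) (B : BaseInstance S C) (Q : BCQ S C) :
    KBEntails P B Q ↔ Satisfies ((tgraphLinear P H E).eval B.toFacts) Q := by
  have hB : B.toFacts ⊆ Set.range toFact := Set.image_subset_range _ _
  constructor
  · intro hQ
    obtain ⟨M, -, hM, -⟩ := hfes B
    -- An answer to `Q` assigns a term to every variable, in particular to variable `0`, even if `C`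
    -- is empty.
    have : Nonempty (GTerm S C) := ⟨(hQ M hM).choose 0⟩
    refine (hQ _ (isModel_chaseLimit P B.toFacts)).of_entails
      (entails_chaseLimit_of_forall hP hB ?_)
    rintro _ ⟨f, hf, rfl⟩
    exact entails_eval_chaseLimit_singleton hP hfes hH ⟨f, hf, rfl⟩ (B.ext f hf)
  · intro hQ M hM
    refine hQ.of_entails ((hM.entails_chaseLimit hB).trans (.of_subset ?_))
    exact LabelledGraph.eval_subset_chaseLimit
      (isEG_tgraphLinear hP fun f hf => (hH.base f hf).1).rule_mem _

end Graph

end TrigGraph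

theorem mainTheorem2 {S : TrigGraph.Schema} {C : Type*}
    (P : TrigGraph.Program S) (hlin : TrigGraph.IsLinear P) (hfes : TrigGraph.IsFES C P)
    (H : Set (TrigGraph.Atom S C)) (hH : TrigGraph.IsPatternSet P H)
    (E : (f : TrigGraph.Atom S C) →
      TrigGraph.ChaseGraph P ({TrigGraph.toFact f} : TrigGraph.Facts S C)) :
    TrigGraph.IsTG C P (TrigGraph.tgraphLinear P H E) ∧
      ((∀ f ∈ H, (E f).IsSingle) → (TrigGraph.tgraphLinear P H E).AtMostOneParent) :=
  ⟨fun B => ⟨TrigGraph.isEG_tgraphLinear hlin fun f hf => (hH.base f hf).1,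
    TrigGraph.kbEntails_iff_satisfies_eval hlin hfes hH B⟩,
    TrigGraph.atMostOneParent_tgraphLinear⟩
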